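/- Conventions. A code of length $N$ over a field $F$ is an $F$-subspace of $F^N$; its square $\mathcal A^{\star 2}$ is the span of all componentwise products of two words of $\mathcal A$. For a support $\mathbf x=(x_0,\dots,x_{N-1})\in\mathbb F_{q^2}^N$ (pairwise distinct entries) and $\mathbf y\in\mathbb F_{q^2}^N$ with nonzero entries, the alternant code of degree $\ell$ is $\mathcal A_\ell(\mathbf x,\mathbf y)=\{v\in\mathbb F_q^N : \sum_i y_ip(x_i)v_i=0 \text{ for all } p\in\mathbb F_{q^2}[z],\ \deg p<\ell\}$, and for $G\in\mathbb F_{q^2}[z]$ without zero among the $x_i$ the Goppa code is $\Gamma(\mathbf x,G)=\mathcal A_{\deg G}(\mathbf x,G(\mathbf x)^{-1})$. For a code $\mathcal C$ of length $n$ and $I\subseteq\{0,\dots,n-1\}$, $\mathcal S_I(\mathcal C)$ is the shortened code (words of $\mathcal C$ vanishing on $I$, with the positions in $I$ deleted), $\mathbf x_I$ is $\mathbf x$ with the positions in $I$ deleted, and $\pi_I(z)=\prod_{i\notin I}(z-x_i)$. Theorem. Let $q$ be a prime power, $1\le r<q$, $n>2r(q+1)$, let $\mathbf x\in\mathbb F_{q^2}^n$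 be a support, $\gamma\in\mathbb F_{q^2}[z]$ of degree $r$ with $\gamma(x_i)\ne0$ for all $i$, and $\mathcal C=\Gamma(\mathbf x,\gamma^{q-1})$ the Goppa code over $\mathbb F_q$. Assume $$\binom{r(r+2)+1}{2}>2r(q+1)-2 .$$ Put $a_-=n-2r(q+1)$. Among the integers $a$ with $n-a-2r(q+1)+r(r+2)>0$ and $$\binom{n-a-2r(q+1)+r(r+2)+1}{2}>3(n-a)-4r(q+1)-2$$ there is a largest one, $a_+$, and $1\le a_-\le a_+\le n$. For every $I\subseteq\{0,\dots,n-1\}$ with $a_-\le|I|\le a_+$ for which the designed dimensions are attained, that is, with $N=n-|I|$, $$\dim\mathcal S_I(\mathcal C)=N-2r(q+1)+r(r+2),\qquad \dim\mathcal A_{2r(q+1)+1-N}(\mathbf x_I,\mathbf y)=3N-4r(q+1)-2,$$ where $\mathbf y=\gamma(\mathbf x_I)^{-2(q+1)}\star\pi_I'(\mathbf x_I)$, the dimension of $\mathcal S_I(\mathcal C)^{\star2}$ is smaller than $\dim\mathcal R^{\star2}$ for almost all codes $\mathcal R\subseteq\mathbb F_q^{N}$ with $\dim\mathcal R=\dim\mathcal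 S_I(\mathcal C)$. Here "almost all" means: for every $\varepsilon>0$ there is $q_0$ depending only on $\varepsilon$ such that, whenever $q\ge q_0$, for all $n,r,\mathbf x,\gamma,I$ as above the proportion of such codes $\mathcal R$ with $\dim\mathcal R^{\star2}>\dim\mathcal S_I(\mathcal C)^{\star2}$ is at least $1-\varepsilon$. -/

import Mathlib

open Polynomial

namespace WildGoppa

/- A code of length `N` over `F` is an `F`-subspace of `ι → F`, where `ι` is a finite index set
with `N` elements; its dimension is its `finrank`. -/

/-- The shortened code: the words of `C` that vanish on `I`, with the entries indexed by `I`
removed. -/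
def shorten {F ι : Type*} [Field F] (C : Submodule F (ι → F)) (I : Finset ι) :
    Submodule F ({i : ι // i ∉ I} → F) where
  carrier := {w | ∃ c ∈ C, (∀ i ∈ I, c i = 0) ∧ ∀ j : {i : ι // i ∉ I}, w j = c j}
  zero_mem' := ⟨0, C.zero_mem, by simp, by simp⟩
  add_mem' := by
    rintro v w ⟨c, hc, hc0, hv⟩ ⟨d, hd, hd0, hw⟩
    exact ⟨c + d, C.add_mem hc hd, fun i hi => by simp [hc0 i hi, hd0 i hi],
      fun j => by simp [hv j, hw j]⟩
  smul_mem' := by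
    rintro a v ⟨c, hc, hc0, hv⟩
    exact ⟨a • c, C.smul_mem a hc, fun i hi => by simp [hc0 i hi], fun j => by simp [hv j]⟩

/-- The dual code for the standard bilinear form `∑ i, c i * v i`. -/
def dual {F ι : Type*} [Field F] [Fintype ι] (C : Submodule F (ι → F)) :
    Submodule F (ι → F) where
  carrier := {v | ∀ c ∈ C, ∑ i, c i * v i = 0}
  zero_mem' := by intro c _; simp
  add_mem' := by
    intro v w hv hw c hc
    simp [mul_add, Finset.sum_add_distrib, hv c hc, hw c hc]
  smul_mem' := by
    intro a v hv c hc
    have h : ∑ i, c i * (a • v) i = a * ∑ i, c i * v i := by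
      rw [Finset.mul_sum]
      exact Finset.sum_congr rfl fun i _ => by simp only [Pi.smul_apply, smul_eq_mul]; ring
    rw [h, hv c hc, mul_zero]

/-- The subfield subcode `D ∩ K ^ N` of a code `D` over an extension `L` of `K`. -/
def subfieldSubcode (K : Type*) {L ι : Type*} [Field K] [Field L] [Algebra K L]
    (D : Submodule L (ι → L)) : Submodule K (ι → K) :=
  (D.restrictScalars K).comap ((Algebra.linearMap K L).compLeft ι)

/-- The generalized Reed-Solomon code: the words `(y i * p (x i))` with `deg p < k`. -/
noncomputable def GRS {L ι : Type*} [Field L] (k : ℕ) (x y : ι → L) : Submodule L (ι → L) :=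
  (degreeLT L k).map (LinearMap.pi fun i => y i • Polynomial.leval (x i))

/-- The alternant code over `K` of degree `l` with support `x` and multiplier `y`. -/
noncomputable def alternant (K : Type*) {L ι : Type*} [Field K] [Field L] [Algebra K L] [Fintype ι]
    (l : ℕ) (x y : ι → L) : Submodule K (ι → K) :=
  subfieldSubcode K (dual (GRS l x y))

/-- The classical Goppa code over `K` with support `x` and Goppa polynomial `G`. -/
noncomputable def goppa (K : Type*) {L ι : Type*} [Field K] [Field L] [Algebra K L] [Fintype ι]
    (x : ι → L) (G : L[X]) : Submodule K (ι → K) :=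
  alternant K G.natDegree x fun i => (G.eval (x i))⁻¹

/-- The locator polynomial `∏ i, (X - x i)`. -/
noncomputable def locator {L ι : Type*} [Field L] [Fintype ι] (x : ι → L) : L[X] :=
  ∏ i, (X - C (x i))

/-- The square code: the span of all componentwise products of two words of `A`. -/
def square {F ι : Type*} [Field F] (A : Submodule F (ι → F)) : Submodule F (ι → F) :=
  Submodule.span F {w | ∃ a ∈ A, ∃ b ∈ A, w = a * b}

/-- The alternant code of degree `2 r (q + 1) + 1 - N` (with `N` the number of elements of `ι`)
in which the square of `Γ(x, γ ^ (q + 1)) = A_{r (q + 1)}(x, γ(x) ^ (-(q + 1)))` is naturally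
contained; its multiplier is `γ(x) ^ (-2 (q + 1)) * π'(x)` with `π` the locator polynomial of
`x`. It is used only for `N ≤ 2 r (q + 1)`, where the subtraction does not truncate. -/
noncomputable def squareAlternant (K : Type*) {L ι : Type*} [Field K] [Field L] [Algebra K L]
    [Fintype ι] (q r : ℕ) (x : ι → L) (γ : L[X]) : Submodule K (ι → K) :=
  alternant K (2 * r * (q + 1) + 1 - Fintype.card ι) x fun i =>
    ((γ.eval (x i)) ^ (2 * (q + 1)))⁻¹ * (derivative (locator x)).eval (x i)

/-- The number of codes of dimension `k` in `F ^ ι`. -/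
noncomputable def numCodes (F ι : Type*) [Field F] (k : ℕ) : ℕ :=
  Nat.card {R : Submodule F (ι → F) // Module.finrank F R = k}

/-- The number of codes of dimension `k` in `F ^ ι` whose square has dimension larger
than `d`. -/
noncomputable def numCodesLargeSquare (F ι : Type*) [Field F] (k d : ℕ) : ℕ :=
  Nat.card {R : Submodule F (ι → F) //
    Module.finrank F R = k ∧ d < Module.finrank F (square R)}

end WildGoppa

/-!
The theorem compares the square of a shortened wild Goppa code, which is small for algebraic
reasons, with the square of a random code, which is as large as the trivial bounds allow.

Algebraic side. Let `l = r * (q + 1)` and let `x_I` be the support outside `I`. The code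
`Γ(x_I, γ ^ (q + 1))` is contained in the shortening of `Γ(x, γ ^ (q - 1))`
(`alternant_le_shorten_goppa`). Its multiplier is a norm and so lies in `K`; hence its parity checks
of exponents `a + q * b` and `b + q * a` are conjugate, and it has at least the designed dimension
(`le_finrank_alternant`). If the shortening has exactly the designed dimension, the two codes
coincide. By Lagrange interpolation, words of an alternant code of degree `l` are values of
polynomials of degree less than `N - l`, and products of such polynomials satisfy the parity checks
of an alternant code of degree `2 * l + 1 - N` (`square_alternant_le`). So the square has
dimension at most `D = 3 * N - 4 * r * (q + 1) - 2`, and the choice of `I` gives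
`D < (k + 1).choose 2` and `D < N`.

Probabilistic side. The square of the row space of a `k × N` matrix consists of the values of
quadratic forms at its columns. The square has dimension at least `m` as soon as quadratic forms
take arbitrary values at some `m` of the columns. If they do not, the space of forms vanishing at
these columns is larger than expected by a factor `q` at least, so it suffices to bound the expected
size of that space by a constant times its expected size in general position; this gives a failure
probability of order `1 / q`. By interchanging sums this amounts to bounding the `m`-th moment of
the number of zeros of a random quadratic form (`sum_card_level_zero_pow_le`). Forms whose polar
form has large rank have close to `q ^ (k - 1)` zeros, by a second moment computation valid in every
characteristic (`card_level_zero_le_of_rank`); the other nonzero forms have at most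
`2 * q ^ (k - 1)` zeros (`card_mul_card_level_zero_le`), and they are too few to matter
(`card_rank_le`). Here `k` may be assumed large, as it is bounded below in terms of `q`
(`le_of_lt_mul`). Finally all codes of dimension `k` have the same number of bases
(`card_linearIndependent_span`), which carries the count from matrices to codes.
-/

namespace WildGoppa

/-! ### Alternant codes: shortening and squares -/

section Alternant

variable {K L ι : Type*} [Field K] [Field L] [Algebra K L] [Fintype ι]

theorem mem_alternant {l : ℕ} {x y : ι → L} {v : ι → K} :
    v ∈ alternant K l x y ↔
      ∀ p : L[X], p.degree < l → ∑ i, y i * p.eval (x i) * algebraMap K L (v i) = 0 := by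
  simp only [alternant, subfieldSubcode, dual, GRS, Submodule.mem_comap,
    Submodule.restrictScalars_mem, Submodule.mem_mk, AddSubmonoid.mem_mk, Submodule.mem_map,
    AddSubsemigroup.mem_mk, Set.mem_ofPred_eq, Polynomial.mem_degreeLT, forall_exists_index, and_imp,
    forall_apply_eq_imp_iff₂]
  rfl

/-- Deleting zero entries does not affect the parity checks, and `γ ^ (q - 1)` has fewer parity
checks than `γ ^ (q + 1)`: a test polynomial `p` for the former is the test polynomial
`p * γ ^ 2` for the latter. -/
theorem alternant_le_shorten_goppa [DecidableEq ι] (x : ι → L) (γ : L[X])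
    (hγ0 : γ ≠ 0) (hγ : ∀ i, γ.eval (x i) ≠ 0) (I : Finset ι) {q : ℕ} (hq : 1 ≤ q) :
    alternant K (γ.natDegree * (q + 1)) (fun j : {i // i ∉ I} => x j)
        (fun j => (γ.eval (x j) ^ (q + 1))⁻¹) ≤
      shorten (goppa K x (γ ^ (q - 1))) I := by
  intro w hw
  rw [mem_alternant] at hw
  refine ⟨fun i => if h : i ∉ I then w ⟨i, h⟩ else 0, ?_, ?_, ?_⟩
  · rw [goppa, mem_alternant]
    intro p hp
    rw [natDegree_pow] at hp
    have hdeg : (p * γ ^ 2).degree < ((γ.natDegree * (q + 1) : ℕ) : WithBot ℕ) := by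
      rcases eq_or_ne p 0 with rfl | hp0
      · rw [zero_mul, degree_zero]
        exact WithBot.bot_lt_coe _
      · have h1 := (natDegree_lt_iff_degree_lt hp0).2 hp
        rw [← natDegree_lt_iff_degree_lt (mul_ne_zero hp0 (pow_ne_zero 2 hγ0)),
          natDegree_mul hp0 (pow_ne_zero 2 hγ0), natDegree_pow]
        obtain ⟨s, rfl⟩ := Nat.exists_eq_add_of_le' hq
        rw [Nat.add_sub_cancel] at h1
        nlinarith
    have h := hw (p * γ ^ 2) hdeg
    rw [← Fintype.sum_subtype_add_sum_subtype (fun i => i ∉ I), ← h]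
    rw [add_eq_left.2]
    · refine Finset.sum_congr rfl fun i _ => ?_
      have h0 := hγ i
      rw [dif_pos i.2, eval_mul, eval_pow, eval_pow, show q + 1 = (q - 1) + 2 by omega, pow_add]
      field_simp
    · refine Finset.sum_eq_zero fun i _ => ?_
      rw [dif_neg i.2, map_zero, mul_zero]
  · intro i hi
    simp [hi]
  · intro j
    simp [j.2]

theorem eval_derivative_locator [DecidableEq ι] (x : ι → L) (i : ι) :
    (derivative (locator x)).eval (x i) = ∏ j ∈ Finset.univ.erase i, (x i - x j) := by
  rw [locator, derivative_prod_finset, eval_finsetSum, Finset.sum_eq_single i]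
  · simp [eval_prod]
  · intro j _ hji
    rw [eval_mul, eval_prod, Finset.prod_eq_zero (i := i), zero_mul]
    · simpa using hji.symm
    · simp
  · simp

theorem eval_derivative_locator_ne_zero {x : ι → L} (hx : Function.Injective x) (i : ι) :
    (derivative (locator x)).eval (x i) ≠ 0 := by
  classical
  rw [eval_derivative_locator, Finset.prod_ne_zero_iff]
  intro j hj
  exact sub_ne_zero.2 fun h => (Finset.ne_of_mem_erase hj) (hx h).symm

/-- The top coefficient of the Lagrange interpolant: the residue identity behind the duality of
generalized Reed-Solomon codes. -/
theorem sum_eval_div_derivative_locator {x : ι → L} (hx : Function.Injective x) {f : L[X]}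
    (hf : f.degree < Fintype.card ι) :
    ∑ i, f.eval (x i) / (derivative (locator x)).eval (x i) = f.coeff (Fintype.card ι - 1) := by
  classical
  rw [← Finset.card_univ, Lagrange.coeff_eq_sum (v := x) hx.injOn (by simpa using hf)]
  simp_rw [eval_derivative_locator]

/-- Words of an alternant code of degree `l` come from polynomials of degree less than `N - l`. -/
theorem exists_polynomial_of_mem_alternant {l : ℕ} {x y : ι → L} (hx : Function.Injective x)
    {v : ι → K} (hv : v ∈ alternant K l x y) :
    ∃ f : L[X], (f = 0 ∨ f.natDegree + l < Fintype.card ι) ∧ ∀ i,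
      f.eval (x i) = y i * algebraMap K L (v i) * (derivative (locator x)).eval (x i) := by
  classical
  set z : ι → L := fun i => y i * algebraMap K L (v i) * (derivative (locator x)).eval (x i)
    with hz
  set f := Lagrange.interpolate Finset.univ x z with hf
  have hfx : ∀ i, f.eval (x i) = z i := fun i =>
    Lagrange.eval_interpolate_at_node z hx.injOn (Finset.mem_univ i)
  have hfd : f.degree < Fintype.card ι := by
    exact Lagrange.degree_interpolate_lt (s := Finset.univ) (v := x) z hx.injOn
  refine ⟨f, ?_, hfx⟩
  by_contra! hcon
  obtain ⟨hf0, hle⟩ := hcon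
  have hnd : f.natDegree < Fintype.card ι := (natDegree_lt_iff_degree_lt hf0).2 hfd
  -- pairing with the monomial that moves the leading coefficient to degree `N - 1`
  set e := Fintype.card ι - 1 - f.natDegree with he
  have h1 := mem_alternant.1 hv (X ^ e) (by
    rw [degree_X_pow]; exact_mod_cast (by omega : e < l))
  have h2 := sum_eval_div_derivative_locator hx (f := f * X ^ e) (by
    rw [degree_mul, degree_X_pow, degree_eq_natDegree hf0]
    exact_mod_cast (by omega : f.natDegree + e < Fintype.card ι))
  rw [show Fintype.card ι - 1 = f.natDegree + e by omega, coeff_mul_X_pow] at h2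
  apply hf0
  rw [← leadingCoeff_eq_zero, leadingCoeff, ← h2, ← h1]
  refine Finset.sum_congr rfl fun i _ => ?_
  have := eval_derivative_locator_ne_zero hx i
  rw [eval_mul, hfx, hz]
  field_simp

/-- Products of two words come from products of two polynomials, so the square of an alternant
code satisfies the parity checks of an alternant code of smaller degree. -/
theorem square_alternant_le {l : ℕ} {x y : ι → L} (hx : Function.Injective x) :
    square (alternant K l x y) ≤ alternant K (2 * l + 1 - Fintype.card ι) x
      (fun i => y i ^ 2 * (derivative (locator x)).eval (x i)) := by
  rw [square, Submodule.span_le]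
  rintro _ ⟨v, hv, w, hw, rfl⟩
  obtain ⟨f, hf, hfx⟩ := exists_polynomial_of_mem_alternant hx hv
  obtain ⟨g, hg, hgx⟩ := exists_polynomial_of_mem_alternant hx hw
  rw [SetLike.mem_coe, mem_alternant]
  intro p hp
  have key : ∑ i, (f * g * p).eval (x i) / (derivative (locator x)).eval (x i) = 0 := by
    rcases eq_or_ne (f * g * p) 0 with h0 | h0
    · simp [h0]
    · have hp0 : p ≠ 0 := right_ne_zero_of_mul h0
      have hfg := left_ne_zero_of_mul h0
      have hf0 := left_ne_zero_of_mul hfg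
      have hg0 := right_ne_zero_of_mul hfg
      have hp' := (natDegree_lt_iff_degree_lt hp0).2 hp
      have h1 := hf.resolve_left hf0
      have h2 := hg.resolve_left hg0
      have hd : (f * g * p).natDegree < Fintype.card ι - 1 := by
        rw [natDegree_mul hfg hp0, natDegree_mul hf0 hg0]; omega
      rw [sum_eval_div_derivative_locator hx, coeff_eq_zero_of_natDegree_lt hd]
      exact (natDegree_lt_iff_degree_lt h0).1 (by omega)
  rw [← key]
  refine Finset.sum_congr rfl fun i _ => ?_
  have := eval_derivative_locator_ne_zero hx i
  rw [eval_mul, eval_mul, hfx, hgx, Pi.mul_apply, map_mul]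
  field_simp

end Alternant

/-! ### Alternant codes over a quadratic extension with multiplier in the base field -/

section Dimension

variable {K L : Type*} [Field K] [Field L] [Algebra K L]

/-- The vectors over `L` on which the coordinate map `σ` acts as the endomorphism `φ` applied to
each coordinate. -/
def twistedFixed {T : Type*} (φ : L →ₐ[K] L) (σ : T → T) : Submodule K (T → L) where
  carrier := {t | ∀ j, t (σ j) = φ (t j)}
  zero_mem' := by intro j; simp
  add_mem' := by intro s t hs ht j; simp [hs j, ht j]
  smul_mem' := by intro a t ht j; simp [ht j]

/-- If `φ η ≠ η` then `F = twistedFixed φ σ` and `η • F` are independent, whence the bound. -/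
theorem two_mul_finrank_twistedFixed_le {T : Type*} [Fintype T] [FiniteDimensional K L]
    (φ : L →ₐ[K] L) (σ : T → T) {η : L} (hη : φ η ≠ η) :
    2 * Module.finrank K (twistedFixed φ σ) ≤ Fintype.card T * Module.finrank K L := by
  have hη0 : η ≠ 0 := by
    rintro rfl
    exact hη (map_zero φ)
  let m : (T → L) →ₗ[K] (T → L) := LinearMap.lsmul L (T → L) η |>.restrictScalars K
  have hm : Function.Injective m := fun s t h => by
    have h' : η • s = η • t := h
    exact smul_right_injective _ hη0 h'
  have hdisj : Disjoint (twistedFixed φ σ) ((twistedFixed φ σ).map m) := by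
    rw [Submodule.disjoint_def]
    rintro _ h1 ⟨t, ht, rfl⟩
    have ht0 : t = 0 := by
      funext j
      have e1 : η * t (σ j) = φ (η * t j) := h1 j
      have e2 : t (σ j) = φ (t j) := ht j
      rw [e2, map_mul] at e1
      by_contra hne
      have : φ (t j) ≠ 0 := by
        rw [Ne, map_eq_zero]; exact hne
      exact hη (mul_right_cancel₀ this e1).symm
    rw [ht0, map_zero]
  have h := Submodule.finrank_add_finrank_le_of_disjoint hdisj
  rw [← (Submodule.equivMapOfInjective m hm (twistedFixed φ σ)).finrank_eq] at h
  rw [Module.finrank_pi_fintype] at h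
  simpa [two_mul] using h

/-- The power sums `∑ i, c i * v i * x i ^ j`, for `j` in a set of exponents. -/
noncomputable def powerSums {ι : Type*} [Fintype ι] (c : ι → K) (x : ι → L) (J : Finset ℕ) :
    (ι → K) →ₗ[K] (J → L) where
  toFun v j := ∑ i, algebraMap K L (c i * v i) * x i ^ (j : ℕ)
  map_add' v w := by
    funext j
    simp [mul_add, add_mul, Finset.sum_add_distrib]
  map_smul' a v := by
    funext j
    simp only [Pi.smul_apply, smul_eq_mul, RingHom.id_apply, Algebra.smul_def, Finset.mul_sum,
      map_mul]
    exact Finset.sum_congr rfl fun i _ => by ring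

/-- The exponents `a + q * b` with `a, b ≤ r`, not both equal to `r`. -/
def symmetricExponents (q r : ℕ) : Finset ℕ :=
  (((Finset.range (r + 1)) ×ˢ (Finset.range (r + 1))).erase (r, r)).image fun p => p.1 + q * p.2

theorem mem_symmetricExponents {q r : ℕ} (hr : r < q) {j : ℕ} :
    j ∈ symmetricExponents q r ↔ j % q ≤ r ∧ j / q ≤ r ∧ ¬ (j % q = r ∧ j / q = r) := by
  simp only [symmetricExponents, Finset.mem_image, Finset.mem_erase, Finset.mem_product,
    Finset.mem_range, Prod.exists, ne_eq, Prod.mk.injEq]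
  constructor
  · rintro ⟨a, b, ⟨hne, ha, hb⟩, rfl⟩
    have h1 : (a + q * b) % q = a := by
      rw [Nat.add_mul_mod_self_left, Nat.mod_eq_of_lt (by omega)]
    have h2 : (a + q * b) / q = b := by
      rw [Nat.add_mul_div_left _ _ (by omega), Nat.div_eq_of_lt (by omega), zero_add]
    rw [h1, h2]
    exact ⟨by omega, by omega, hne⟩
  · rintro ⟨h1, h2, h3⟩
    exact ⟨j % q, j / q, ⟨h3, by omega, by omega⟩, Nat.mod_add_div j q⟩

theorem card_symmetricExponents {q r : ℕ} (hr : r < q) :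
    (symmetricExponents q r).card = r * (r + 2) := by
  rw [symmetricExponents, Finset.card_image_of_injOn, Finset.card_erase_of_mem,
    Finset.card_product, Finset.card_range]
  · rw [show (r + 1) * (r + 1) = r * (r + 2) + 1 by ring, Nat.add_sub_cancel]
  · simp
  · rintro ⟨a, b⟩ h1 ⟨c, d⟩ h2 h
    simp only [Finset.coe_erase, Finset.coe_product, Finset.coe_range, Set.mem_sdiff,
      Set.mem_prod, Set.mem_Iio, Set.mem_singleton_iff] at h1 h2 h
    have h3 : a = c := by
      have := congrArg (· % q) h
      simpa [Nat.add_mul_mod_self_left, Nat.mod_eq_of_lt (show a < q by omega),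
        Nat.mod_eq_of_lt (show c < q by omega)] using this
    subst h3
    have h4 : q * b = q * d := by omega
    rw [Nat.eq_of_mul_eq_mul_left (by omega) h4]

theorem symmetricExponents_subset {q r : ℕ} (hr : r < q) :
    symmetricExponents q r ⊆ Finset.range (r * (q + 1)) := by
  intro j hj
  rw [mem_symmetricExponents hr] at hj
  obtain ⟨h1, h2, h3⟩ := hj
  rw [Finset.mem_range, ← Nat.mod_add_div j q]
  rcases h2.lt_or_eq with h | h
  · have : q * (j / q) + q ≤ q * r := by
      rw [← Nat.mul_succ]; exact Nat.mul_le_mul_left q h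
    have := Nat.mod_lt j (show 0 < q by omega)
    nlinarith
  · have : j % q < r := lt_of_le_of_ne h1 fun h' => h3 ⟨h', h⟩
    rw [h]
    nlinarith

/-- Over a quadratic extension the parity checks of exponents `a + q * b` and `b + q * a` of an
alternant code with multiplier in the base field are conjugate, so `r * (r + 2)` of the
`2 * r * (q + 1)` parity checks over the base field are redundant. -/
theorem le_finrank_alternant [Finite K] {ι : Type*} [Fintype ι] (hKL : Module.finrank K L = 2)
    {q r : ℕ} (hq : Nat.card K = q) (hr : r < q) (c : ι → K) (x : ι → L) :
    Fintype.card ι + r * (r + 2) ≤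
      Module.finrank K (alternant K (r * (q + 1)) x fun i => algebraMap K L (c i)) +
        2 * (r * (q + 1)) := by
  classical
  have : FiniteDimensional K L := Module.finite_of_finrank_eq_succ hKL
  have : Finite L := Module.finite_of_finite K
  have := Fintype.ofFinite K
  have := Fintype.ofFinite L
  have hq' : Fintype.card K = q := by rw [← hq, Nat.card_eq_fintype_card]
  have hL : Fintype.card L = q ^ 2 := by
    rw [← hq', Module.card_eq_pow_finrank (K := K) (V := L), hKL]
  let φ := FiniteField.frobeniusAlgHom K L
  have hφ : ∀ z : L, φ z = z ^ q := fun z => by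
    rw [← hq']; rfl
  obtain ⟨η, hη⟩ : ∃ η : L, φ η ≠ η := by
    by_contra! h
    have h1 : φ = 1 := AlgHom.ext fun z => h z
    have h2 := FiniteField.orderOf_frobeniusAlgHom K L
    rw [show FiniteField.frobeniusAlgHom K L = 1 from h1, orderOf_one, hKL] at h2
    omega
  set T := symmetricExponents q r with hT
  set J := Finset.range (r * (q + 1)) \ T with hJ
  have hswap : ∀ j ∈ T, j / q + q * (j % q) ∈ T := by
    intro j hj
    rw [hT, mem_symmetricExponents hr] at hj ⊢
    have h1 : (j / q + q * (j % q)) % q = j / q := by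
      rw [Nat.add_mul_mod_self_left, Nat.mod_eq_of_lt (by omega)]
    have h2 : (j / q + q * (j % q)) / q = j % q := by
      rw [Nat.add_mul_div_left _ _ (by omega), Nat.div_eq_of_lt (by omega), zero_add]
    rw [h1, h2]
    tauto
  let σ : T → T := fun j => ⟨_, hswap j j.2⟩
  have hfix : ∀ v, powerSums c x T v ∈ twistedFixed φ σ := by
    intro v j
    change ∑ i, algebraMap K L (c i * v i) * x i ^ ((j : ℕ) / q + q * ((j : ℕ) % q)) =
      φ (∑ i, algebraMap K L (c i * v i) * x i ^ (j : ℕ))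
    rw [map_sum]
    refine Finset.sum_congr rfl fun i _ => ?_
    rw [map_mul φ, AlgHom.commutes, hφ]
    congr 1
    have hxi : (x i ^ q) ^ q = x i := by
      rw [← pow_mul, ← sq, ← hL, FiniteField.pow_card]
    conv_rhs => rw [← Nat.mod_add_div (j : ℕ) q, ← pow_mul, add_mul, pow_add,
      show q * ((j : ℕ) / q) * q = q * q * ((j : ℕ) / q) by ring, pow_mul (x i) (q * q),
      pow_mul (x i) q q, hxi]
    rw [pow_add, mul_comm ((j : ℕ) % q) q, mul_comm]
  let Φ : (ι → K) →ₗ[K] (J → L) × twistedFixed φ σ :=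
    (powerSums c x J).prod ((powerSums c x T).codRestrict _ hfix)
  have hker : LinearMap.ker Φ ≤
      alternant K (r * (q + 1)) x fun i => algebraMap K L (c i) := by
    intro v hv
    have hv' : powerSums c x J v = 0 ∧ (powerSums c x T).codRestrict _ hfix v = 0 :=
      Prod.mk_eq_zero.1 hv
    have hsum : ∀ j < r * (q + 1), ∑ i, algebraMap K L (c i * v i) * x i ^ j = 0 := by
      intro j hj
      by_cases hjT : j ∈ T
      · exact congrFun (congrArg Subtype.val hv'.2) ⟨j, hjT⟩
      · exact congrFun hv'.1 ⟨j, by simp [hJ, hj, hjT]⟩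
    rw [mem_alternant]
    intro p hp
    rcases eq_or_ne p 0 with rfl | hp0
    · simp
    have hpd := (natDegree_lt_iff_degree_lt hp0).2 hp
    simp_rw [eval_eq_sum_range' hpd, Finset.mul_sum, Finset.sum_mul]
    rw [Finset.sum_comm]
    refine Finset.sum_eq_zero fun j hj => ?_
    rw [← mul_zero (p.coeff j), ← hsum j (Finset.mem_range.1 hj), Finset.mul_sum]
    refine Finset.sum_congr rfl fun i _ => ?_
    rw [map_mul]
    ring
  have h1 := LinearMap.finrank_range_add_finrank_ker Φ
  have h2 := Submodule.finrank_le (LinearMap.range Φ)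
  have h3 := Submodule.finrank_mono hker
  have h4 := two_mul_finrank_twistedFixed_le φ σ hη
  rw [Module.finrank_prod, Module.finrank_pi_fintype] at h2
  rw [Module.finrank_pi] at h1
  have hTc := card_symmetricExponents hr
  have hJc : J.card + r * (r + 2) = r * (q + 1) := by
    rw [hJ, ← hTc, Finset.card_sdiff_add_card_eq_card (symmetricExponents_subset hr),
      Finset.card_range]
  simp only [hKL, Finset.sum_const, Finset.card_univ, Fintype.card_coe, smul_eq_mul] at h2 h4
  rw [← hT] at hTc
  rw [hTc] at h4
  omega

end Dimension

/-! ### Zeros of quadratic forms over a finite field -/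

section Quadratic

open Matrix

variable {K κ : Type*} [Field K] [Fintype κ]

/-- The quadratic form of a square matrix. Its polar form has the matrix `A + Aᵀ`. -/
def quad (A : Matrix κ κ K) (x : κ → K) : K := x ⬝ᵥ A *ᵥ x

theorem quad_add (A : Matrix κ κ K) (x h : κ → K) :
    quad A (x + h) = quad A x + x ⬝ᵥ (A + Aᵀ) *ᵥ h + quad A h := by
  have : h ⬝ᵥ A *ᵥ x = x ⬝ᵥ Aᵀ *ᵥ h := by
    rw [dotProduct_mulVec, ← mulVec_transpose, dotProduct_comm]
  simp only [quad, mulVec_add, add_mulVec, dotProduct_add, add_dotProduct, this]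
  ring

theorem quad_smul (A : Matrix κ κ K) (t : K) (x : κ → K) : quad A (t • x) = t ^ 2 * quad A x := by
  simp only [quad, mulVec_smul, smul_dotProduct, dotProduct_smul, smul_eq_mul]
  ring

variable [Fintype K]

open Classical in
/-- The vectors at which the quadratic form of `A` takes the value `t`. -/
noncomputable def level (A : Matrix κ κ K) (t : K) : Finset (κ → K) := {x | quad A x = t}

theorem mem_level {A : Matrix κ κ K} {t : K} {x : κ → K} : x ∈ level A t ↔ quad A x = t := by
  simp [level]

/-- A line in a direction `p` with `quad A p ≠ 0` meets the quadric in at most two points. -/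
theorem card_mul_card_level_zero_le {A : Matrix κ κ K} {p : κ → K} (hp : quad A p ≠ 0) :
    Fintype.card K * (level A 0).card ≤ 2 * Fintype.card K ^ Fintype.card κ := by
  classical
  have h1 : ∀ t : K, (Finset.univ.filter fun x => quad A (x + t • p) = 0).card =
      (level A 0).card := by
    intro t
    refine Finset.card_bij (fun x _ => x + t • p) (fun x hx => ?_) (fun x _ y _ h => ?_)
      (fun y hy => ⟨y - t • p, ?_, ?_⟩)
    · simpa [mem_level] using hx
    · simpa using h
    · simpa [mem_level] using hy
    · simp
  have h2 : ∀ x : κ → K, (Finset.univ.filter fun t : K => quad A (x + t • p) = 0).card ≤ 2 := by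
    intro x
    set P : K[X] := C (quad A p) * X ^ 2 + C (x ⬝ᵥ (A + Aᵀ) *ᵥ p) * X + C (quad A x) with hP
    have hdeg : P.natDegree = 2 := natDegree_quadratic hp
    have hP0 : P ≠ 0 := by
      intro h
      rw [h, natDegree_zero] at hdeg
      omega
    calc _ ≤ P.roots.toFinset.card := by
          refine Finset.card_le_card fun t ht => ?_
          rw [Finset.mem_filter, quad_add, quad_smul, mulVec_smul, dotProduct_smul,
            smul_eq_mul] at ht
          rw [Multiset.mem_toFinset, mem_roots hP0, IsRoot.def, ← ht.2, hP]
          simp only [eval_add, eval_mul, eval_C, eval_pow, eval_X]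
          ring
      _ ≤ 2 := (Multiset.toFinset_card_le _).trans ((card_roots' P).trans hdeg.le)
  calc Fintype.card K * (level A 0).card
      = ∑ t : K, (Finset.univ.filter fun x => quad A (x + t • p) = 0).card := by
        simp [h1]
    _ = ∑ x : κ → K, (Finset.univ.filter fun t : K => quad A (x + t • p) = 0).card := by
        simp only [Finset.card_filter]
        exact Finset.sum_comm
    _ ≤ ∑ _x : κ → K, 2 := Finset.sum_le_sum fun x _ => h2 x
    _ = _ := by simp [mul_comm]

open Classical in
theorem card_mul_card_hyperplane {b : κ → K} (hb : b ≠ 0) (c : K) :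
    Fintype.card K * (Finset.univ.filter fun x : κ → K => x ⬝ᵥ b = c).card =
      Fintype.card K ^ Fintype.card κ := by
  let f : (κ → K) →+ K :=
    { toFun := fun x => x ⬝ᵥ b, map_zero' := by simp, map_add' := fun x y => by simp }
  have hf : ∀ c, c ∈ Set.range f := by
    intro c
    obtain ⟨i, hi⟩ := Function.ne_iff.1 hb
    refine ⟨Pi.single i (c / b i), ?_⟩
    change Pi.single i (c / b i) ⬝ᵥ b = c
    rw [single_dotProduct, div_mul_cancel₀ _ hi]
  have h : ∀ d, (Finset.univ.filter fun x : κ → K => x ⬝ᵥ b = d).card =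
      (Finset.univ.filter fun x : κ → K => x ⬝ᵥ b = c).card := fun d =>
    AddMonoidHom.card_fiber_eq_of_mem_range f (hf d) (hf c)
  have := Finset.card_eq_sum_card_fiberwise (s := (Finset.univ : Finset (κ → K)))
    (t := (Finset.univ : Finset K)) (f := fun x => x ⬝ᵥ b) (by simp)
  simp only [h] at this
  simpa using this.symm

open Classical in
/-- The number of pairs of vectors with the same value, counted by their difference `h`: unless
`h` is in the radical of the polar form, this is the number of points of a hyperplane. -/
theorem card_mul_sum_sq_card_level_le (A : Matrix κ κ K) :
    Fintype.card K * ∑ t, (level A t).card ^ 2 ≤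
      (Fintype.card K ^ Fintype.card κ) ^ 2 + Fintype.card K * (Fintype.card K ^ Fintype.card κ *
        (Finset.univ.filter fun h : κ → K => (A + Aᵀ) *ᵥ h = 0).card) := by
  have h1 : ∑ t, (level A t).card ^ 2 =
      ∑ h : κ → K, (Finset.univ.filter fun x : κ → K => quad A (x + h) = quad A x).card := by
    have e1 : ∀ t, (level A t).card ^ 2 = ∑ x, ∑ y,
        if quad A x = t ∧ quad A y = t then 1 else 0 := by
      intro t
      rw [sq, level, Finset.card_filter, Finset.sum_mul_sum]
      simp only [ite_and, mul_ite, mul_one, mul_zero]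
      refine Finset.sum_congr rfl fun x _ => Finset.sum_congr rfl fun y _ => ?_
      split_ifs <;> rfl
    simp_rw [e1, Finset.card_filter]
    rw [Finset.sum_comm,
      Finset.sum_comm (f := fun h x => if quad A (x + h) = quad A x then 1 else 0)]
    refine Finset.sum_congr rfl fun x _ => ?_
    rw [Finset.sum_comm]
    refine (Fintype.sum_equiv (Equiv.addLeft x) _ _ fun h => ?_).symm
    rw [Equiv.coe_addLeft, Finset.sum_eq_single (quad A x)]
    · simp only [true_and]
    · exact fun t _ ht => if_neg fun h => ht h.1.symm
    · exact fun h => absurd (Finset.mem_univ _) h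
  have h2 : ∀ h : κ → K, Fintype.card K *
      (Finset.univ.filter fun x : κ → K => quad A (x + h) = quad A x).card ≤
      Fintype.card K ^ Fintype.card κ + Fintype.card K * (if (A + Aᵀ) *ᵥ h = 0 then
        Fintype.card K ^ Fintype.card κ else 0) := by
    intro h
    split_ifs with h0
    · refine le_add_left (Nat.mul_le_mul_left _ ((Finset.card_le_univ _).trans (by simp)))
    · rw [mul_zero, add_zero, ← card_mul_card_hyperplane h0 (-quad A h)]
      refine Nat.mul_le_mul_left _ (Finset.card_le_card fun x hx => ?_)
      rw [Finset.mem_filter, quad_add] at hx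
      rw [Finset.mem_filter]
      refine ⟨Finset.mem_univ _, ?_⟩
      linear_combination hx.2
  rw [h1, Finset.mul_sum]
  refine (Finset.sum_le_sum fun h _ => h2 h).trans ?_
  rw [Finset.sum_add_distrib, ← Finset.mul_sum, ← Finset.sum_filter, Finset.sum_const,
    Finset.sum_const, Finset.card_univ, Fintype.card_fun, smul_eq_mul, smul_eq_mul, sq,
    mul_comm (Finset.card _)]

open Classical in
theorem card_radical_mul_le {A : Matrix κ κ K} {s : ℕ} (hs : s ≤ (A + Aᵀ).rank) :
    (Finset.univ.filter fun h : κ → K => (A + Aᵀ) *ᵥ h = 0).card * Fintype.card K ^ s ≤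
      Fintype.card K ^ Fintype.card κ := by
  have h1 := LinearMap.finrank_range_add_finrank_ker (A + Aᵀ).mulVecLin
  rw [Module.finrank_pi] at h1
  have h2 : (Finset.univ.filter fun h : κ → K => (A + Aᵀ) *ᵥ h = 0).card =
      Fintype.card (LinearMap.ker (A + Aᵀ).mulVecLin) := by
    rw [Fintype.card_subtype]
    congr 1
    ext h
    simp only [Finset.mem_filter, LinearMap.mem_ker, Matrix.mulVecLin_apply]
  rw [h2, Module.card_eq_pow_finrank (K := K), ← pow_add]
  refine Nat.pow_le_pow_right Fintype.card_pos ?_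
  rw [Matrix.rank] at hs
  omega

/-- By the second moment of the value distribution, quadrics of large rank contain about the
expected number of points. This holds in every characteristic. -/
theorem card_level_zero_le_of_rank {A : Matrix κ κ K} (hA : 8 ≤ (A + Aᵀ).rank) :
    ((level A 0).card : ℝ) ≤ (Fintype.card K : ℝ) ^ Fintype.card κ / Fintype.card K *
      (1 + 1 / (Fintype.card K : ℝ) ^ 3) := by
  classical
  have hq : (0 : ℝ) < Fintype.card K := by exact_mod_cast Fintype.card_pos
  set q : ℝ := ((Fintype.card K : ℕ) : ℝ) with hqdef
  set R : ℝ := ((Finset.univ.filter fun h : κ → K => (A + Aᵀ) *ᵥ h = 0).card : ℝ) with hR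
  set V : ℝ := q ^ Fintype.card κ with hV
  have hVpos : 0 < V := by positivity
  have h1 : q * ∑ t, ((level A t).card : ℝ) ^ 2 ≤ V ^ 2 + q * (V * R) := by
    rw [hV, hqdef, hR]
    exact_mod_cast card_mul_sum_sq_card_level_le A
  have h2 : R * q ^ 8 ≤ V := by
    rw [hV, hqdef, hR]
    exact_mod_cast card_radical_mul_le hA
  have h3 : ∑ t, ((level A t).card : ℝ) = V := by
    have := Finset.card_eq_sum_card_fiberwise (s := (Finset.univ : Finset (κ → K)))
      (t := (Finset.univ : Finset K)) (f := quad A) (by simp)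
    rw [Finset.card_univ, Fintype.card_fun] at this
    rw [hV, hqdef, ← Nat.cast_pow, this]
    push_cast
    rfl
  have h4 : ((level A 0).card - V / q) ^ 2 ≤ ∑ t, ((level A t).card - V / q) ^ 2 :=
    Finset.single_le_sum (f := fun t => (((level A t).card : ℝ) - V / q) ^ 2)
      (fun t _ => sq_nonneg _) (Finset.mem_univ 0)
  have h5 : ∑ t, (((level A t).card : ℝ) - V / q) ^ 2 =
      ∑ t, ((level A t).card : ℝ) ^ 2 - V ^ 2 / q := by
    simp_rw [sub_sq]
    rw [Finset.sum_add_distrib, Finset.sum_sub_distrib, ← Finset.sum_mul, ← Finset.mul_sum, h3,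
      Finset.sum_const, Finset.card_univ, nsmul_eq_mul]
    field_simp
    ring
  have h6 : (((level A 0).card : ℝ) - V / q) ^ 2 ≤ (V / q ^ 4) ^ 2 := by
    have e1 : ∑ t, ((level A t).card : ℝ) ^ 2 ≤ V ^ 2 / q + V * R := by
      rw [← mul_le_mul_iff_right₀ hq]
      refine h1.trans (le_of_eq ?_)
      field_simp
    have e2 : V * R ≤ (V / q ^ 4) ^ 2 := by
      rw [div_pow, le_div_iff₀ (by positivity)]
      calc V * R * (q ^ 4) ^ 2 = V * (R * q ^ 8) := by ring
        _ ≤ V * V := by gcongr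
        _ = V ^ 2 := by ring
    linarith
  have h7 := abs_le_of_sq_le_sq h6 (by positivity)
  have h8 : V / q * (1 + 1 / q ^ 3) = V / q + V / q ^ 4 := by
    field_simp
  rw [h8]
  linarith [(abs_le.1 h7).2]

end Quadratic

/-! ### Counting quadratic forms of small rank -/

section Counting

open Matrix

variable {K : Type*} [Field K]

/-- A matrix of rank at most `s` is a product of matrices with inner dimension `s`. -/
theorem exists_eq_mul_of_rank_le {m n : Type*} [Fintype n] [Fintype m]
    {B : Matrix m n K} {s : ℕ} (hB : B.rank ≤ s) :
    ∃ (V : Matrix m (Fin s) K) (W : Matrix (Fin s) n K), B = V * W := by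
  classical
  obtain ⟨f, hf⟩ := finrank_le_iff_exists_linearMap.1
    (show Module.finrank K (LinearMap.range B.mulVecLin) ≤ Module.finrank K (Fin s → K) by
      rwa [Module.finrank_fin_fun])
  obtain ⟨g, hg⟩ := f.exists_leftInverse_of_injective (LinearMap.ker_eq_bot.2 hf)
  refine ⟨LinearMap.toMatrix' ((LinearMap.range B.mulVecLin).subtype ∘ₗ g),
    LinearMap.toMatrix' (f ∘ₗ B.mulVecLin.rangeRestrict), ?_⟩
  rw [← LinearMap.toMatrix'_comp, LinearMap.comp_assoc, ← LinearMap.comp_assoc _ f g, hg,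
    LinearMap.id_comp]
  exact (LinearMap.toMatrix'_toLin' B).symm

variable [Fintype K]

theorem card_ordered_pairs (k : ℕ) :
    Fintype.card {p : Fin k × Fin k // p.1 < p.2} + (k + 1).choose 2 = k * k ∧
      Fintype.card {p : Fin k × Fin k // p.1 ≤ p.2} = (k + 1).choose 2 := by
  have h1 : Fintype.card {p : Fin k × Fin k // p.1 ≤ p.2} = (k + 1).choose 2 := by
    rw [← Fintype.card_congr Sym2.sortEquiv, Sym2.card, Fintype.card_fin]
  refine ⟨?_, h1⟩
  rw [← h1]
  have h2 := Fintype.card_subtype_compl (fun p : Fin k × Fin k => p.1 ≤ p.2)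
  have h3 : Fintype.card {p : Fin k × Fin k // ¬ p.1 ≤ p.2} =
      Fintype.card {p : Fin k × Fin k // p.1 < p.2} :=
    Fintype.card_congr ((Equiv.prodComm _ _).subtypeEquiv fun p => by simp)
  have h4 := Fintype.card_subtype_le (fun p : Fin k × Fin k => p.1 ≤ p.2)
  simp only [Fintype.card_prod, Fintype.card_fin] at h2 h4
  omega

open Classical in
/-- A matrix whose quadratic form vanishes identically is alternating, hence determined by its
entries above the diagonal. -/
theorem card_quad_eq_zero_mul_le (k : ℕ) :
    (Finset.univ.filter fun A : Matrix (Fin k) (Fin k) K => ∀ x, quad A x = 0).card *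
      Fintype.card K ^ (k + 1).choose 2 ≤ Fintype.card K ^ (k * k) := by
  rw [← (card_ordered_pairs k).1, pow_add]
  refine Nat.mul_le_mul_right _ ?_
  rw [← Fintype.card_fun, ← Finset.card_univ]
  refine Finset.card_le_card_of_injOn (fun A p => A p.1.1 p.1.2) (by simp) ?_
  have key : ∀ A : Matrix (Fin k) (Fin k) K, (∀ x, quad A x = 0) →
      (∀ i, A i i = 0) ∧ ∀ i j, A i j = - A j i := by
    intro A hA
    have hd : ∀ i, A i i = 0 := fun i => by
      simpa [quad] using hA (Pi.single i 1)
    refine ⟨hd, fun i j => ?_⟩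
    have := hA (Pi.single i 1 + Pi.single j 1)
    rw [quad_add, hA, hA, zero_add, add_zero] at this
    simp at this
    exact eq_neg_of_add_eq_zero_left this
  intro A hA B hB h
  simp only [Finset.coe_filter, Finset.mem_univ, true_and, Set.mem_ofPred_eq] at hA hB
  obtain ⟨hA1, hA2⟩ := key A hA
  obtain ⟨hB1, hB2⟩ := key B hB
  have hlt : ∀ i j, i < j → A i j = B i j := fun i j hij => congrFun h ⟨(i, j), hij⟩
  ext i j
  rcases lt_trichotomy i j with hij | rfl | hij
  · exact hlt i j hij
  · rw [hA1, hB1]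
  · rw [hA2, hB2, hlt j i hij]

open Classical in
/-- The matrix `A` is determined by the matrix `A + Aᵀ` of its polar form and by its entries on
and above the diagonal. -/
theorem card_rank_le (k s : ℕ) :
    (Finset.univ.filter fun A : Matrix (Fin k) (Fin k) K => (A + Aᵀ).rank ≤ s).card ≤
      Fintype.card K ^ ((k + 1).choose 2 + 2 * s * k) := by
  have h1 : (Finset.univ.filter fun B : Matrix (Fin k) (Fin k) K => B.rank ≤ s).card ≤
      Fintype.card K ^ (2 * s * k) := by
    calc _ ≤ (Finset.univ.image fun p : Matrix (Fin k) (Fin s) K × Matrix (Fin s) (Fin k) K =>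
          p.1 * p.2).card := by
          refine Finset.card_le_card fun B hB => ?_
          obtain ⟨V, W, rfl⟩ := exists_eq_mul_of_rank_le (Finset.mem_filter.1 hB).2
          exact Finset.mem_image.2 ⟨(V, W), Finset.mem_univ _, rfl⟩
      _ ≤ _ := Finset.card_image_le
      _ = Fintype.card K ^ (2 * s * k) := by
          rw [Finset.card_univ, Fintype.card_prod]
          change Fintype.card (Fin k → Fin s → K) * Fintype.card (Fin s → Fin k → K) = _
          simp only [Fintype.card_fun, Fintype.card_fin]
          rw [← pow_mul, ← pow_mul, ← pow_add]
          congr 1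
          ring
  calc _ ≤ ((Finset.univ : Finset ({p : Fin k × Fin k // p.1 ≤ p.2} → K)) ×ˢ
        (Finset.univ.filter fun B : Matrix (Fin k) (Fin k) K => B.rank ≤ s)).card := by
        refine Finset.card_le_card_of_injOn (fun A => (fun p => A p.1.1 p.1.2, A + Aᵀ)) ?_ ?_
        · intro A hA
          simpa using hA
        · intro A _ B _ h
          simp only [Prod.mk.injEq] at h
          have hle : ∀ i j, i ≤ j → A i j = B i j := fun i j hij => congrFun h.1 ⟨(i, j), hij⟩
          ext i j
          rcases le_total i j with hij | hij
          · exact hle i j hij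
          · have := congrFun (congrFun h.2 i) j
            simpa [hle j i hij] using this
    _ ≤ _ := by
        rw [Finset.card_product, pow_add, Finset.card_univ, Fintype.card_fun, (card_ordered_pairs k).2]
        exact Nat.mul_le_mul_left _ h1

/-- The moment of the number of zeros of a random quadratic form. Generic forms contribute the
main term; identically vanishing forms, and forms of small rank, are rare. -/
theorem sum_card_level_zero_pow_le {k m : ℕ} (hk : 67 ≤ k) (hq : 4 ≤ Fintype.card K)
    (hm : m ≤ (k + 1).choose 2) (hmq : m ≤ Fintype.card K ^ 2) :
    ∑ A : Matrix (Fin k) (Fin k) K, ((level A 0).card : ℝ) ^ m ≤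
      5 * (Fintype.card K : ℝ) ^ (k * k) * ((Fintype.card K : ℝ) ^ k / Fintype.card K) ^ m := by
  classical
  set q : ℝ := ((Fintype.card K : ℕ) : ℝ) with hqdef
  have hq4 : (4 : ℝ) ≤ q := by rw [hqdef]; exact_mod_cast hq
  have hq0 : 0 < q := by linarith
  set V : ℝ := q ^ k / q with hV
  have hV0 : 0 < V := by positivity
  set M := (k + 1).choose 2 with hM
  have hM2 : 2 * M = k * (k + 1) := by
    rw [hM, Nat.choose_two_right, Nat.add_sub_cancel, mul_comm (k + 1) k,
      Nat.mul_div_cancel' (Nat.even_mul_succ_self k).two_dvd]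
  set Z : Finset (Matrix (Fin k) (Fin k) K) := Finset.univ.filter fun A => ∀ x, quad A x = 0
  set R : Finset (Matrix (Fin k) (Fin k) K) := Finset.univ.filter fun A => (A + Aᵀ).rank ≤ 8
  have hlevel : ∀ A : Matrix (Fin k) (Fin k) K, ((level A 0).card : ℝ) ^ m ≤
      (if ∀ x, quad A x = 0 then (q * V) ^ m else 0) +
        (if (A + Aᵀ).rank ≤ 8 then (2 * V) ^ m else 0) + 3 * V ^ m := by
    intro A
    by_cases hA : ∀ x, quad A x = 0
    · rw [if_pos hA]
      have h1 : ((level A 0).card : ℝ) ≤ q * V := by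
        rw [hV, mul_div_cancel₀ _ hq0.ne', hqdef]
        have := Finset.card_le_univ (level A 0)
        rw [Fintype.card_fun, Fintype.card_fin] at this
        exact_mod_cast this
      have h2 : ((level A 0).card : ℝ) ^ m ≤ (q * V) ^ m := by gcongr
      have h3 : 0 ≤ (if (A + Aᵀ).rank ≤ 8 then (2 * V) ^ m else 0) := by
        split_ifs <;> positivity
      have h4 : 0 ≤ 3 * V ^ m := by positivity
      linarith
    rw [if_neg hA, zero_add]
    by_cases hA2 : (A + Aᵀ).rank ≤ 8
    · rw [if_pos hA2]
      push Not at hA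
      obtain ⟨p, hp⟩ := hA
      have h1 : ((level A 0).card : ℝ) ≤ 2 * V := by
        rw [hV, ← mul_div_assoc, le_div_iff₀ hq0, mul_comm, hqdef]
        have := card_mul_card_level_zero_le hp
        rw [Fintype.card_fin] at this
        exact_mod_cast this
      have h2 : ((level A 0).card : ℝ) ^ m ≤ (2 * V) ^ m := by gcongr
      have h4 : 0 ≤ 3 * V ^ m := by positivity
      linarith
    · rw [if_neg hA2, zero_add]
      have h1 : ((level A 0).card : ℝ) ≤ V * (1 + 1 / q ^ 3) := by
        have := card_level_zero_le_of_rank (A := A) (by omega)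
        rwa [Fintype.card_fin] at this
      have h2 : ((level A 0).card : ℝ) ^ m ≤ (V * (1 + 1 / q ^ 3)) ^ m := by gcongr
      have h3 : (1 + 1 / q ^ 3) ^ m ≤ 3 := by
        calc (1 + 1 / q ^ 3) ^ m ≤ (Real.exp (1 / q ^ 3)) ^ m := by
              gcongr
              rw [add_comm]
              exact Real.add_one_le_exp _
          _ = Real.exp (m * (1 / q ^ 3)) := by rw [← Real.exp_nat_mul]
          _ ≤ Real.exp 1 := by
              gcongr
              rw [mul_one_div, div_le_one (by positivity)]
              calc (m : ℝ) ≤ q ^ 2 := by rw [hqdef]; exact_mod_cast hmq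
                _ ≤ q ^ 3 := by gcongr <;> linarith
          _ ≤ 3 := by linarith [Real.exp_one_lt_d9]
      calc _ ≤ (V * (1 + 1 / q ^ 3)) ^ m := h2
        _ = V ^ m * (1 + 1 / q ^ 3) ^ m := mul_pow _ _ _
        _ ≤ V ^ m * 3 := by gcongr
        _ = 3 * V ^ m := mul_comm _ _
  have hZ : (Z.card : ℝ) * q ^ M ≤ q ^ (k * k) := by
    rw [hqdef]
    exact_mod_cast card_quad_eq_zero_mul_le (K := K) k
  have hR : (R.card : ℝ) ≤ q ^ (M + 2 * 8 * k) := by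
    rw [hqdef]
    exact_mod_cast card_rank_le (K := K) k 8
  have hcard : ((Finset.univ : Finset (Matrix (Fin k) (Fin k) K)).card : ℝ) = q ^ (k * k) := by
    rw [Finset.card_univ]
    change ((Fintype.card (Fin k → Fin k → K) : ℕ) : ℝ) = _
    simp only [Fintype.card_fun, Fintype.card_fin]
    rw [← pow_mul, hqdef]
    push_cast
    rfl
  have hmain1 : (Z.card : ℝ) * (q * V) ^ m ≤ q ^ (k * k) * V ^ m := by
    rw [mul_pow, ← mul_assoc]
    gcongr
    refine le_trans ?_ hZ
    gcongr
    linarith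
  have hmain2 : (R.card : ℝ) * (2 * V) ^ m ≤ q ^ (k * k) * V ^ m := by
    rw [mul_pow, ← mul_assoc]
    gcongr
    refine (mul_le_mul hR (pow_le_pow_right₀ one_le_two hm) (by positivity)
      (by positivity)).trans ?_
    -- compare squares, using `2 ^ 2 ≤ q`
    rw [← pow_le_pow_iff_left₀ (by positivity) (by positivity) two_ne_zero]
    calc (q ^ (M + 2 * 8 * k) * 2 ^ M) ^ 2 = q ^ (2 * (M + 2 * 8 * k)) * 4 ^ M := by
          rw [mul_pow, ← pow_mul, ← pow_mul, mul_comm M 2, pow_mul 2 2 M, mul_comm _ 2]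
          norm_num
      _ ≤ q ^ (2 * (M + 2 * 8 * k)) * q ^ M := by gcongr
      _ = q ^ (2 * (M + 2 * 8 * k) + M) := (pow_add _ _ _).symm
      _ ≤ q ^ (k * k * 2) := by
          refine pow_le_pow_right₀ (by linarith) ?_
          nlinarith
      _ = (q ^ (k * k)) ^ 2 := pow_mul _ _ _
  calc _ ≤ ∑ A : Matrix (Fin k) (Fin k) K, ((if ∀ x, quad A x = 0 then (q * V) ^ m else 0) +
        (if (A + Aᵀ).rank ≤ 8 then (2 * V) ^ m else 0) + 3 * V ^ m) :=
        Finset.sum_le_sum fun A _ => hlevel A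
    _ = Z.card * (q * V) ^ m + R.card * (2 * V) ^ m + q ^ (k * k) * (3 * V ^ m) := by
        rw [Finset.sum_add_distrib, Finset.sum_add_distrib, ← Finset.sum_filter,
          ← Finset.sum_filter, Finset.sum_const, Finset.sum_const, Finset.sum_const,
          nsmul_eq_mul, nsmul_eq_mul, nsmul_eq_mul, hcard]
    _ ≤ 5 * q ^ (k * k) * V ^ m := by linarith

end Counting

/-! ### Squares of random codes -/

section RandomSquare

open Matrix

variable {K : Type*} [Field K]

/-- The values of the quadratic form of `A` at the columns of the matrix with rows `g`. These
words form the square of the row space. -/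
def evalQuad {κ ι : Type*} [Fintype κ] (g : κ → ι → K) : Matrix κ κ K →ₗ[K] (ι → K) where
  toFun A i := quad A fun a => g a i
  map_add' A B := by
    funext i
    simp [quad, add_mulVec]
  map_smul' c A := by
    funext i
    simp [quad, smul_mulVec]

theorem evalQuad_mem_square {κ ι : Type*} [Fintype κ] {g : κ → ι → K} {R : Submodule K (ι → K)}
    (hg : ∀ a, g a ∈ R) (A : Matrix κ κ K) : evalQuad g A ∈ square R := by
  have h : evalQuad g A = ∑ a, ∑ b, A a b • (g a * g b) := by
    funext i
    simp only [evalQuad, LinearMap.coe_mk, AddHom.coe_mk, quad, dotProduct, mulVec,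
      Finset.sum_apply, Pi.smul_apply, Pi.mul_apply, smul_eq_mul, Finset.mul_sum]
    exact Finset.sum_congr rfl fun a _ => Finset.sum_congr rfl fun b _ => by ring
  rw [h]
  exact Submodule.sum_mem _ fun a _ => Submodule.sum_mem _ fun b _ =>
    Submodule.smul_mem _ _ (Submodule.subset_span ⟨_, hg a, _, hg b, rfl⟩)

variable {ι : Type*} [Fintype ι]

/-- The values of the quadratic form of `A` at the columns with index in `S`. -/
def evalQuadOn {κ : Type*} [Fintype κ] (S : Finset ι) (g : κ → ι → K) :
    Matrix κ κ K →ₗ[K] (S → K) :=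
  LinearMap.funLeft K K (fun i : S => (i : ι)) ∘ₗ evalQuad g

theorem card_le_finrank_square {κ : Type*} [Fintype κ] {S : Finset ι} {g : κ → ι → K}
    {R : Submodule K (ι → K)} (hg : ∀ a, g a ∈ R) (hS : Function.Surjective (evalQuadOn S g)) :
    S.card ≤ Module.finrank K (square R) := by
  let f : square R →ₗ[K] (S → K) :=
    LinearMap.funLeft K K (fun i : S => (i : ι)) ∘ₗ (square R).subtype
  have hf : Function.Surjective f := fun s => by
    obtain ⟨A, hA⟩ := hS s
    exact ⟨⟨evalQuad g A, evalQuad_mem_square hg A⟩, hA⟩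
  simpa using LinearMap.finrank_le_finrank_of_surjective hf

variable [Fintype K]

open Classical in
/-- The first moment of the number of quadratic forms vanishing at the columns in `S`, computed by
counting the matrices with given zeros. -/
theorem sum_card_ker_evalQuadOn (k : ℕ) (S : Finset ι) :
    ∑ g : Fin k → ι → K,
        (Finset.univ.filter fun A : Matrix (Fin k) (Fin k) K => evalQuadOn S g A = 0).card =
      ∑ A : Matrix (Fin k) (Fin k) K,
        (level A 0).card ^ S.card * (Fintype.card K ^ k) ^ (Fintype.card ι - S.card) := by
  simp only [Finset.card_filter]
  rw [Finset.sum_comm]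
  refine Finset.sum_congr rfl fun A _ => ?_
  rw [← Finset.card_filter]
  have h1 : (Finset.univ.filter fun g : Fin k → ι → K => evalQuadOn S g A = 0).card =
      (Fintype.piFinset fun i : ι => if i ∈ S then level A 0 else Finset.univ).card := by
    refine Finset.card_equiv (Equiv.piComm fun (_ : Fin k) (_ : ι) => K) fun g => ?_
    simp only [Finset.mem_filter, Finset.mem_univ, true_and, Fintype.mem_piFinset]
    rw [funext_iff]
    constructor
    · intro h i
      split_ifs with hi
      · exact mem_level.2 (h ⟨i, hi⟩)
      · exact Finset.mem_univ _
    · intro h i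
      have := h i
      rw [if_pos i.2] at this
      exact mem_level.1 this
  rw [h1, Fintype.card_piFinset]
  have h2 : ∀ i : ι, (if i ∈ S then level A 0 else Finset.univ).card =
      if i ∈ S then (level A 0).card else Fintype.card K ^ k := by
    intro i
    split_ifs
    · rfl
    · simp
  simp_rw [h2]
  rw [Finset.prod_ite, Finset.prod_const, Finset.prod_const]
  congr 2
  · simp
  · rw [← Finset.card_compl]
    congr 1
    ext i
    simp

open Classical in
/-- For most matrices, quadratic forms take arbitrary values at the columns in `S`. If not, the
forms vanishing at these columns are at least `q` times as many as in general position, which the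
first moment makes rare. -/
theorem card_not_surjective_evalQuadOn_le {k : ℕ} (S : Finset ι) (hk : 67 ≤ k)
    (hq : 4 ≤ Fintype.card K) (hS : S.card ≤ (k + 1).choose 2) (hSq : S.card ≤ Fintype.card K ^ 2) :
    ((Fintype.card K : ℝ) - 1) * (Finset.univ.filter fun g : Fin k → ι → K =>
        ¬ Function.Surjective (evalQuadOn S g)).card ≤
      4 * (Fintype.card K : ℝ) ^ (k * Fintype.card ι) := by
  set q : ℝ := ((Fintype.card K : ℕ) : ℝ) with hqdef
  have hq4 : (4 : ℝ) ≤ q := by rw [hqdef]; exact_mod_cast hq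
  have hq0 : 0 < q := by linarith
  set N := Fintype.card ι with hN
  set m := S.card with hm
  have hmN : m ≤ N := Finset.card_le_univ S
  set bad := Finset.univ.filter fun g : Fin k → ι → K => ¬ Function.Surjective (evalQuadOn S g)
    with hbad
  have hker : ∀ g : Fin k → ι → K, q ^ (k * k) * (1 + (if g ∈ bad then q - 1 else 0)) ≤
      q ^ m * (Finset.univ.filter fun A : Matrix (Fin k) (Fin k) K =>
        evalQuadOn S g A = 0).card := by
    intro g
    have h1 := LinearMap.finrank_range_add_finrank_ker (evalQuadOn S g)
    rw [Module.finrank_matrix, Module.finrank_self, mul_one, Fintype.card_fin] at h1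
    have h2 : (Finset.univ.filter fun A : Matrix (Fin k) (Fin k) K =>
        evalQuadOn S g A = 0).card =
        Fintype.card K ^ Module.finrank K (LinearMap.ker (evalQuadOn S g)) := by
      rw [← Module.card_eq_pow_finrank, Fintype.card_subtype]
      congr 1
      ext A
      simp only [Finset.mem_filter, LinearMap.mem_ker]
    rw [h2, Nat.cast_pow, ← hqdef, ← pow_add, ← h1]
    have h3 : Module.finrank K (S → K) = m := by simp [hm]
    split_ifs with hg
    · have hlt : Module.finrank K (LinearMap.range (evalQuadOn S g)) < m := by
        rw [← h3]
        refine Submodule.finrank_lt fun htop => ?_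
        exact (Finset.mem_filter.1 hg).2 (LinearMap.range_eq_top.1 htop)
      rw [add_sub_cancel, ← pow_succ]
      exact pow_le_pow_right₀ (by linarith) (by omega)
    · have hle := Submodule.finrank_le (LinearMap.range (evalQuadOn S g))
      rw [add_zero, mul_one]
      exact pow_le_pow_right₀ (by linarith) (by omega)
  have hsum := Finset.sum_le_sum fun g (_ : g ∈ Finset.univ) => hker g
  rw [← Finset.mul_sum, ← Finset.mul_sum, Finset.sum_add_distrib, ← Finset.sum_filter,
    Finset.filter_mem_eq_inter, Finset.univ_inter, Finset.sum_const, Finset.sum_const,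
    nsmul_eq_mul, nsmul_eq_mul, ← Nat.cast_sum, sum_card_ker_evalQuadOn, Nat.cast_sum] at hsum
  have hcard : ((Finset.univ : Finset (Fin k → ι → K)).card : ℝ) = q ^ (k * N) := by
    rw [Finset.card_univ]
    simp only [Fintype.card_fun, Fintype.card_fin]
    rw [← pow_mul, hqdef, mul_comm k]
    push_cast
    rfl
  rw [hcard, mul_one] at hsum
  have hmom : q ^ m * ∑ A : Matrix (Fin k) (Fin k) K,
      (((level A 0).card ^ m * (Fintype.card K ^ k) ^ (N - m) : ℕ) : ℝ) ≤
      q ^ (k * k) * (5 * q ^ (k * N)) := by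
    push_cast
    rw [← hqdef, ← Finset.sum_mul]
    calc q ^ m * ((∑ A : Matrix (Fin k) (Fin k) K, ((level A 0).card : ℝ) ^ m) *
          (q ^ k) ^ (N - m))
        ≤ q ^ m * ((5 * q ^ (k * k) * (q ^ k / q) ^ m) * (q ^ k) ^ (N - m)) := by
          gcongr
          exact sum_card_level_zero_pow_le hk hq hS hSq
      _ = q ^ (k * k) * (5 * ((q * (q ^ k / q)) ^ m * (q ^ k) ^ (N - m))) := by
          rw [mul_pow]
          ring
      _ = q ^ (k * k) * (5 * q ^ (k * N)) := by
          rw [mul_div_cancel₀ _ hq0.ne', ← pow_add, Nat.add_sub_cancel' hmN, ← pow_mul]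
  have := le_of_mul_le_mul_left (hsum.trans hmom) (by positivity)
  linarith

end RandomSquare

/-! ### From generator matrices to codes -/

section Codes

variable {K : Type*} [Field K] {V : Type*} [AddCommGroup V] [Module K V] [Finite V]

/-- Every subspace of dimension `k` has the same number of ordered bases, namely the number of
linearly independent `k`-tuples in `K ^ k`. -/
theorem card_linearIndependent_span (k : ℕ) (P : Submodule K V → Prop) :
    Nat.card {g : Fin k → V // LinearIndependent K g ∧ P (Submodule.span K (Set.range g))} =
      Nat.card {R : Submodule K V // Module.finrank K R = k ∧ P R} *
        Nat.card {g : Fin k → Fin k → K // LinearIndependent K g} := by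
  have : FiniteDimensional K V := inferInstance
  let F : {g : Fin k → V // LinearIndependent K g ∧ P (Submodule.span K (Set.range g))} →
      {R : Submodule K V // Module.finrank K R = k ∧ P R} := fun g =>
    ⟨Submodule.span K (Set.range g.1), by
      rw [finrank_span_eq_card g.2.1, Fintype.card_fin], g.2.2⟩
  have hfib : ∀ R, Nat.card {g // F g = R} =
      Nat.card {g : Fin k → Fin k → K // LinearIndependent K g} := by
    rintro ⟨R, hR, hP⟩
    have e : {g // F g = ⟨R, hR, hP⟩} ≃ {g : Fin k → R // LinearIndependent K g} :=
      { toFun := fun g => ⟨fun a => ⟨g.1.1 a, by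
          have h : Submodule.span K (Set.range g.1.1) = R := congrArg Subtype.val g.2
          exact h.le (Submodule.subset_span ⟨a, rfl⟩)⟩, by
            refine LinearIndependent.of_comp R.subtype ?_
            exact g.1.2.1⟩
        invFun := fun g =>
          have hli : LinearIndependent K fun a => (g.1 a : V) :=
            g.2.map' R.subtype (Submodule.ker_subtype R)
          have hspan : Submodule.span K (Set.range fun a => (g.1 a : V)) = R := by
            refine Submodule.eq_of_le_of_finrank_eq ?_ ?_
            · rw [Submodule.span_le]
              rintro _ ⟨a, rfl⟩
              exact (g.1 a).2
            · rw [finrank_span_eq_card hli, Fintype.card_fin, hR]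
          ⟨⟨fun a => (g.1 a : V), hli, by rw [hspan]; exact hP⟩, Subtype.ext hspan⟩
        left_inv := fun g => rfl
        right_inv := fun g => rfl }
    rw [Nat.card_congr e]
    have e2 : R ≃ₗ[K] (Fin k → K) :=
      LinearEquiv.ofFinrankEq _ _ (by rw [hR, Module.finrank_fin_fun])
    refine Nat.card_congr ((Equiv.arrowCongr (Equiv.refl _) e2.toEquiv).subtypeEquiv fun g => ?_)
    exact (LinearMap.linearIndependent_iff e2.toLinearMap e2.ker).symm
  have := Fintype.ofFinite {R : Submodule K V // Module.finrank K R = k ∧ P R}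
  rw [Nat.card_congr (Equiv.sigmaFiberEquiv F).symm, Nat.card_sigma]
  simp only [hfib, Finset.sum_const, Finset.card_univ, smul_eq_mul]
  rw [← Nat.card_eq_fintype_card]

variable [Fintype K]

/-- If `k < N`, at least half of the `k`-tuples in `K ^ N` are linearly independent. -/
theorem half_le_card_linearIndependent {k : ℕ} (hk : k < Module.finrank K V) :
    (Fintype.card K : ℝ) ^ (k * Module.finrank K V) / 2 ≤
      Nat.card {g : Fin k → V // LinearIndependent K g} := by
  have : FiniteDimensional K V := inferInstance
  set q : ℝ := ((Fintype.card K : ℕ) : ℝ) with hqdef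
  have hq2 : (2 : ℝ) ≤ q := by rw [hqdef]; exact_mod_cast Fintype.one_lt_card
  set N := Module.finrank K V
  rw [card_linearIndependent hk.le]
  have hcast : ((∏ i : Fin k, (Fintype.card K ^ N - Fintype.card K ^ (i : ℕ)) : ℕ) : ℝ) =
      ∏ i ∈ Finset.range k, (q ^ N - q ^ i) := by
    rw [Finset.prod_range, Nat.cast_prod]
    refine Finset.prod_congr rfl fun i _ => ?_
    rw [Nat.cast_sub (Nat.pow_le_pow_right Fintype.card_pos (by omega)), hqdef]
    push_cast
    rfl
  rw [hcast]
  -- losing `q ^ i` out of `q ^ N` at each step loses at most `q ^ k / q ^ N` in total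
  have key : ∀ j ≤ k, (q ^ N) ^ j * (1 - q ^ j / q ^ N) ≤
      ∏ i ∈ Finset.range j, (q ^ N - q ^ i) := by
    intro j
    induction j with
    | zero =>
      intro _
      rw [pow_zero, one_mul, Finset.prod_range_zero]
      have : 0 ≤ q ^ 0 / q ^ N := by positivity
      linarith
    | succ j ih =>
      intro hj
      have h0 : 0 ≤ q ^ N - q ^ j := sub_nonneg.2 (pow_le_pow_right₀ (by linarith) (by omega))
      rw [Finset.prod_range_succ]
      refine le_trans ?_ (mul_le_mul_of_nonneg_right (ih (by omega)) h0)
      have hqN : 0 < q ^ N := by positivity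
      have e1 : q ^ N - q ^ j = q ^ N * (1 - q ^ j / q ^ N) := by field_simp
      rw [e1]
      set z := q ^ j / q ^ N with hz
      have hz0 : 0 ≤ z := by positivity
      have e2 : q ^ (j + 1) / q ^ N = q * z := by rw [hz]; ring
      rw [e2, pow_succ]
      have e3 : (q ^ N) ^ j * q ^ N * (1 - q * z) ≤
          (q ^ N) ^ j * q ^ N * ((1 - z) * (1 - z)) := by
        gcongr
        nlinarith
      linarith
  refine le_trans ?_ (key k le_rfl)
  rw [mul_comm k N, pow_mul, div_eq_mul_one_div]
  gcongr
  have hz : q ^ k / q ^ N ≤ 1 / 2 := by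
    rw [div_le_div_iff₀ (by positivity) two_pos, one_mul]
    calc q ^ k * 2 ≤ q ^ k * q := by gcongr
      _ = q ^ (k + 1) := (pow_succ q k).symm
      _ ≤ q ^ N := pow_le_pow_right₀ (by linarith) hk
  linarith

end Codes

/-- Almost all codes of dimension `k` have a square of dimension larger than `d`, as long as this
does not contradict the trivial bounds on the dimension of a square. -/
theorem one_sub_mul_numCodes_le {K ι : Type*} [Field K] [Finite K] [Fintype ι] {k d : ℕ} {ε : ℝ}
    (hk : 67 ≤ k) (hkN : k < Fintype.card ι) (hq : 4 ≤ Nat.card K) (hd : d < (k + 1).choose 2)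
    (hdN : d < Fintype.card ι) (hN : Fintype.card ι ≤ Nat.card K ^ 2)
    (hε : 8 ≤ ε * (Nat.card K - 1)) :
    (1 - ε) * (numCodes K ι k : ℝ) ≤ numCodesLargeSquare K ι k d := by
  classical
  have := Fintype.ofFinite K
  rw [Nat.card_eq_fintype_card] at hq hN hε
  set q : ℝ := ((Fintype.card K : ℕ) : ℝ) with hqdef
  have hq4 : (4 : ℝ) ≤ q := by rw [hqdef]; exact_mod_cast hq
  obtain ⟨S, -, hS⟩ := Finset.exists_subset_card_eq (s := (Finset.univ : Finset ι)) (n := d + 1)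
    (by rw [Finset.card_univ]; exact hdN)
  set N := Fintype.card ι
  set numBad := Nat.card {R : Submodule K (ι → K) // Module.finrank K R = k ∧
    ¬ d < Module.finrank K (square R)} with hnumBad
  set u := Nat.card {g : Fin k → Fin k → K // LinearIndependent K g} with hu
  have hall : (q ^ (k * N)) / 2 ≤ numCodes K ι k * (u : ℝ) := by
    have h1 := card_linearIndependent_span (K := K) (V := ι → K) k (fun _ => True)
    have h2 := half_le_card_linearIndependent (K := K) (V := ι → K) (k := k)
      (by rwa [Module.finrank_pi])
    rw [Module.finrank_pi] at h2
    simp only [and_true] at h1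
    rw [h1] at h2
    rw [Nat.cast_mul] at h2
    exact h2
  have hbad : (q - 1) * (numBad * (u : ℝ)) ≤ 4 * q ^ (k * N) := by
    have h1 := card_linearIndependent_span (K := K) (V := ι → K) k
      (fun R => ¬ d < Module.finrank K (square R))
    have h2 := card_not_surjective_evalQuadOn_le (K := K) S hk hq (by omega) (by omega)
    refine le_trans (mul_le_mul_of_nonneg_left ?_ (by linarith)) h2
    rw [hnumBad, hu, ← Nat.cast_mul, ← h1, Nat.card_eq_fintype_card, Fintype.card_subtype,
      Nat.cast_le]
    refine Finset.card_le_card fun g hg => ?_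
    rw [Finset.mem_filter] at hg ⊢
    refine ⟨hg.1, fun hsurj => hg.2.2 ?_⟩
    have := card_le_finrank_square (R := Submodule.span K (Set.range g))
      (fun a => Submodule.subset_span ⟨a, rfl⟩) hsurj
    omega
  have hsplit : numCodes K ι k = numCodesLargeSquare K ι k d + numBad := by
    rw [numCodes, numCodesLargeSquare, hnumBad]
    simp only [Nat.card_eq_fintype_card, Fintype.card_subtype]
    rw [← Finset.card_filter_add_card_filter_not (fun R => d < Module.finrank K (square R)),
      Finset.filter_filter, Finset.filter_filter]
  have hu0 : (0 : ℝ) < u := by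
    have h0 : (0 : ℝ) ≤ u := Nat.cast_nonneg u
    rcases h0.eq_or_lt with h | h
    · rw [← h, mul_zero] at hall
      have : 0 < q ^ (k * N) := by positivity
      linarith
    · exact h
  have h3 : (q - 1) * numBad ≤ 8 * numCodes K ι k := by
    refine le_of_mul_le_mul_right ?_ hu0
    linarith
  have h4 : (q - 1) * numBad ≤ (q - 1) * (ε * numCodes K ι k) := by
    refine h3.trans ?_
    rw [← mul_assoc, mul_comm (q - 1)]
    gcongr
  have h5 := le_of_mul_le_mul_left h4 (by linarith)
  have h6 : (numCodes K ι k : ℝ) = numCodesLargeSquare K ι k d + numBad := by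
    exact_mod_cast hsplit
  linarith

/-! ### Shortened Goppa codes and their parameters -/

/-- Over a quadratic extension `z ^ (q + 1)` is the norm of `z`. -/
theorem exists_algebraMap_eq_inv_pow {K L : Type*} [Field K] [Finite K] [Field L] [Algebra K L]
    (hKL : Module.finrank K L = 2) {q : ℕ} (hq : Nat.card K = q) (z : L) :
    ∃ c : K, algebraMap K L c = (z ^ (q + 1))⁻¹ := by
  have : FiniteDimensional K L := Module.finite_of_finrank_eq_succ hKL
  have : Finite L := Module.finite_of_finite K
  refine ⟨(Algebra.norm K z)⁻¹, ?_⟩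
  rw [map_inv₀, FiniteField.algebraMap_norm_eq_pow_sum, hKL, hq, Finset.sum_range_succ,
    Finset.sum_range_one, pow_zero, pow_one, add_comm 1 q]

/-- A shortening of `Γ(x, γ ^ (q - 1))` of the designed dimension coincides with
`Γ(x_I, γ ^ (q + 1))`, whose square is contained in an alternant code. -/
theorem finrank_square_shorten_goppa_le {K L ι : Type*} [Field K] [Finite K] [Field L]
    [Algebra K L] [Fintype ι] [DecidableEq ι] (hKL : Module.finrank K L = 2) {q r : ℕ}
    (hq : Nat.card K = q) (hrq : r < q) {x : ι → L} (hx : Function.Injective x) {γ : L[X]}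
    (hγ0 : γ ≠ 0) (hγ : ∀ i, γ.eval (x i) ≠ 0) (hr : γ.natDegree = r) (I : Finset ι)
    (hdim : Module.finrank K (shorten (goppa K x (γ ^ (q - 1))) I) + 2 * (r * (q + 1)) =
      Fintype.card {i // i ∉ I} + r * (r + 2)) :
    Module.finrank K (square (shorten (goppa K x (γ ^ (q - 1))) I)) ≤
      Module.finrank K (squareAlternant K q r (fun j : {i // i ∉ I} => x j) γ) := by
  have hle := alternant_le_shorten_goppa (K := K) x γ hγ0 hγ I (q := q) (by omega)
  rw [hr] at hle
  choose c hc using fun j : {i // i ∉ I} => exists_algebraMap_eq_inv_pow hKL hq (γ.eval (x j))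
  have h1 := le_finrank_alternant hKL hq hrq c (fun j : {i // i ∉ I} => x j)
  rw [show (fun i => algebraMap K L (c i)) =
    fun j : {i // i ∉ I} => (γ.eval (x j) ^ (q + 1))⁻¹ from funext hc] at h1
  have heq := Submodule.eq_of_le_of_finrank_le hle (by omega)
  rw [← heq]
  have hx' : Function.Injective fun j : {i // i ∉ I} => x j := hx.comp Subtype.val_injective
  have h2 := square_alternant_le (K := K) (l := r * (q + 1))
    (y := fun j : {i // i ∉ I} => (γ.eval (x j) ^ (q + 1))⁻¹) hx'
  refine Submodule.finrank_mono (h2.trans (le_of_eq ?_))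
  rw [squareAlternant]
  congr 1
  · rw [mul_assoc]
  · funext j
    rw [inv_pow, ← pow_mul, mul_comm (q + 1) 2]

/-- In terms of the dimension `k`, the condition on the number of shortened positions. -/
theorem lt_choose_two_iff {k c : ℤ} (hk : 0 ≤ k) :
    c < ((k + 1).toNat.choose 2 : ℤ) ↔ 2 * c < k * (k + 1) := by
  lift k to ℕ using hk
  rw [show (k : ℤ) + 1 = ((k + 1 : ℕ) : ℤ) by push_cast; rfl, Int.toNat_natCast]
  have h : 2 * (k + 1).choose 2 = k * (k + 1) := by
    rw [Nat.choose_two_right, Nat.add_sub_cancel, mul_comm (k + 1) k,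
      Nat.mul_div_cancel' (Nat.even_mul_succ_self k).two_dvd]
  zify at h
  push_cast at *
  constructor <;> intro h' <;> linarith

/-- Since `c ≥ -2`, the condition `3 * k + c < (k + 1).choose 2` is monotone in `k ≥ 1`: it forces
`k ≥ 5`, and `k * (k + 1) - 6 * k` increases from there on. -/
theorem lt_mul_of_le {k k₀ c : ℤ} (hc : -2 ≤ c) (hk₀ : 0 < k₀)
    (h : 2 * (3 * k₀ + c) < k₀ * (k₀ + 1)) (hk : k₀ ≤ k) : 2 * (3 * k + c) < k * (k + 1) := by
  have h5 : 5 ≤ k₀ := by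
    by_contra! hlt
    nlinarith [mul_nonneg (show 0 ≤ k₀ - 1 by omega) (show 0 ≤ 4 - k₀ by omega)]
  nlinarith [mul_nonneg (show 0 ≤ k - k₀ by omega) (show 0 ≤ k + k₀ - 5 by omega)]

/-- The dimension `k` grows with `q`, since `3 * k + c < (k + 1).choose 2` where `c` is at least
about `q`. The value `67` is what the count of forms of small rank needs. -/
theorem le_of_lt_mul {q r k : ℤ} (hr : 2 ≤ r) (hrq : 2 * r + 1 ≤ q) (hq : 4100 ≤ q) (hk : 0 < k)
    (h : 2 * (3 * k + (2 * r * (q + 1) - 3 * (r * (r + 2)) - 2)) < k * (k + 1)) : 67 ≤ k := by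
  by_contra! hlt
  have h1 : k * (k + 1) - 6 * k ≤ 4026 := by
    nlinarith [mul_nonneg (show 0 ≤ 66 - k by omega) (show 0 ≤ k by omega)]
  have h2 : 2 * (q - 5) ≤ r * (4 * q - 6 * r - 8) :=
    mul_le_mul hr (by linarith) (by linarith) (by linarith)
  linarith

/-- A support of length `n > 2 * r * (q + 1)` needs `q > 2 * r`, and the inequality between the
designed dimensions excludes `r = 1`. -/
theorem two_le_and_two_mul_lt {q r n : ℕ} (hr : 1 ≤ r) (hn : 2 * r * (q + 1) < n)
    (hnq : n ≤ q ^ 2) (h : 2 * (r : ℤ) * (q + 1) - 2 < ((r * (r + 2) + 1).choose 2 : ℤ)) :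
    2 ≤ r ∧ 2 * r < q := by
  have hq : 2 * r < q := by
    by_contra! hlt
    nlinarith [Nat.mul_le_mul_right q hlt]
  refine ⟨?_, hq⟩
  by_contra! hlt
  obtain rfl : r = 1 := by omega
  have h3 : ((1 * (1 + 2) + 1).choose 2 : ℕ) = 6 := by decide
  rw [h3] at h
  push_cast at h
  omega

end WildGoppa

open WildGoppa in
theorem theorem3p1 (ε : ℝ) (hε : 0 < ε) :
    ∃ q₀ : ℕ, ∀ (K L : Type*) [Field K] [Finite K] [Field L] [Algebra K L]
      (q n r : ℕ) (x : Fin n → L) (γ : Polynomial L),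
      Nat.card K = q → Module.finrank K L = 2 →
      Function.Injective x → (∀ i, γ.eval (x i) ≠ 0) →
      γ.natDegree = r → 1 ≤ r → r < q → 2 * r * (q + 1) < n →
      2 * (r : ℤ) * (q + 1) - 2 < ((r * (r + 2) + 1).choose 2 : ℤ) →
      ∃ aMinus aPlus : ℤ,
        aMinus = n - 2 * r * (q + 1) ∧
        IsGreatest {a : ℤ | 0 < n - a - 2 * r * (q + 1) + r * (r + 2) ∧
          3 * (n - a) - 4 * r * (q + 1) - 2 <
            ((n - a - 2 * r * (q + 1) + r * (r + 2) + 1).toNat.choose 2 : ℤ)} aPlus ∧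
        1 ≤ aMinus ∧ aMinus ≤ aPlus ∧ aPlus ≤ n ∧
        (q₀ ≤ q → ∀ I : Finset (Fin n), aMinus ≤ (I.card : ℤ) → (I.card : ℤ) ≤ aPlus →
          (Module.finrank K (WildGoppa.shorten (WildGoppa.goppa K x (γ ^ (q - 1))) I) : ℤ) =
            n - I.card - 2 * r * (q + 1) + r * (r + 2) →
          (Module.finrank K (WildGoppa.squareAlternant K q r
              (fun j : {i : Fin n // i ∉ I} => x j) γ) : ℤ) =
            3 * (n - I.card) - 4 * r * (q + 1) - 2 →
          (1 - ε) * (WildGoppa.numCodes K {i : Fin n // i ∉ I}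
              (Module.finrank K (WildGoppa.shorten (WildGoppa.goppa K x (γ ^ (q - 1))) I)) : ℝ) ≤
            (WildGoppa.numCodesLargeSquare K {i : Fin n // i ∉ I}
              (Module.finrank K (WildGoppa.shorten (WildGoppa.goppa K x (γ ^ (q - 1))) I))
              (Module.finrank K (WildGoppa.square
                (WildGoppa.shorten (WildGoppa.goppa K x (γ ^ (q - 1))) I))) : ℝ)) := by
  refine ⟨max 4100 (⌈8 / ε⌉₊ + 1), ?_⟩
  intro K L _ _ _ _ q n r x γ hq hKL hx hγ hr hr1 hrq hn hbin
  have : FiniteDimensional K L := Module.finite_of_finrank_eq_succ hKL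
  have : Finite L := Module.finite_of_finite K
  have hnq : n ≤ q ^ 2 := by
    have h1 := Nat.card_le_card_of_injective x hx
    rwa [Nat.card_fin, Module.natCard_eq_pow_finrank (K := K), hKL, hq] at h1
  obtain ⟨hr2, hqr⟩ := two_le_and_two_mul_lt hr1 hn hnq hbin
  have hr2' : (2 : ℤ) ≤ r := by exact_mod_cast hr2
  have hqr' : 2 * (r : ℤ) + 1 ≤ q := by exact_mod_cast hqr
  have hn' : 2 * (r : ℤ) * (q + 1) < n := by exact_mod_cast hn
  -- with `k` the designed dimension, the designed dimension of the alternant code is `3 * k + c`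
  obtain ⟨c, hc⟩ : ∃ c : ℤ, c = 2 * r * (q + 1) - 3 * (r * (r + 2)) - 2 := ⟨_, rfl⟩
  have hc2 : -2 ≤ c := by nlinarith
  set s := {a : ℤ | 0 < n - a - 2 * r * (q + 1) + r * (r + 2) ∧
    3 * (n - a) - 4 * r * (q + 1) - 2 <
      ((n - a - 2 * r * (q + 1) + r * (r + 2) + 1).toNat.choose 2 : ℤ)} with hs
  have hmem : ∀ a : ℤ, a ∈ s ↔ 0 < n - a - 2 * r * (q + 1) + r * (r + 2) ∧
      2 * (3 * (n - a - 2 * r * (q + 1) + r * (r + 2)) + c) <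
        (n - a - 2 * r * (q + 1) + r * (r + 2)) *
          ((n - a - 2 * r * (q + 1) + r * (r + 2)) + 1) := by
    intro a
    refine and_congr_right fun h0 => ?_
    rw [lt_choose_two_iff h0.le, hc]
    ring_nf
  have hminus : (n : ℤ) - 2 * r * (q + 1) ∈ s := by
    refine ⟨by nlinarith, ?_⟩
    rw [show (n : ℤ) - (n - 2 * r * (q + 1)) - 2 * r * (q + 1) + r * (r + 2) + 1 =
      ((r * (r + 2) + 1 : ℕ) : ℤ) by push_cast; ring, Int.toNat_natCast]
    refine lt_of_eq_of_lt ?_ hbin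
    ring
  have hle : ∀ a ∈ s, a ≤ n := by
    intro a ha
    have h0 := ha.1
    nlinarith
  obtain ⟨aPlus, haPlus, hgreatest⟩ := Int.exists_greatest_of_bdd (P := (· ∈ s)) ⟨n, hle⟩
    ⟨_, hminus⟩
  refine ⟨n - 2 * r * (q + 1), aPlus, rfl, ⟨haPlus, fun a ha => hgreatest a ha⟩, by linarith,
    hgreatest _ hminus, hle _ haPlus, ?_⟩
  intro hq₀ I hI1 hI2 hdim hdimA
  have hq1 : 4100 ≤ q := (le_max_left _ _).trans hq₀
  have hq2 : ⌈8 / ε⌉₊ + 1 ≤ q := (le_max_right _ _).trans hq₀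
  have hcard : (Fintype.card {i : Fin n // i ∉ I} : ℤ) = n - I.card := by
    have h1 : Fintype.card {i : Fin n // i ∉ I} = n - I.card := by
      rw [Fintype.card_subtype_compl]
      simp
    have h2 : I.card ≤ n := by simpa using Finset.card_le_univ I
    rw [h1, Nat.cast_sub h2]
  obtain ⟨N, hN⟩ : ∃ N, N = Fintype.card {i : Fin n // i ∉ I} := ⟨_, rfl⟩
  rw [← hN] at hcard
  set k := Module.finrank K (shorten (goppa K x (γ ^ (q - 1))) I) with hk
  have hγ0 : γ ≠ 0 := by
    rintro rfl
    rw [natDegree_zero] at hr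
    omega
  have hsq := finrank_square_shorten_goppa_le hKL hq hrq hx hγ0 hγ hr I (by
    rw [← hk, ← hN]
    zify
    rw [hdim, hcard]
    ring)
  obtain ⟨hk0, hkc⟩ := (hmem aPlus).1 haPlus
  have hkc' : 2 * (3 * (k : ℤ) + c) < k * (k + 1) :=
    lt_mul_of_le hc2 hk0 hkc (by rw [hdim]; linarith)
  have hkpos : (0 : ℤ) < k := by rw [hdim]; linarith
  have hk67 : 67 ≤ k := by
    have hq1' : (4100 : ℤ) ≤ q := by exact_mod_cast hq1
    exact_mod_cast le_of_lt_mul hr2' hqr' hq1' hkpos (hc ▸ hkc')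
  have hD : ((Module.finrank K (square (shorten (goppa K x (γ ^ (q - 1))) I)) : ℕ) : ℤ) ≤
      3 * k + c := by
    refine (Int.ofNat_le.2 hsq).trans ?_
    rw [hdimA, hdim, hc]
    linarith
  refine one_sub_mul_numCodes_le hk67 ?_ (by omega) ?_ ?_ ?_ ?_
  · rw [← hN]
    zify
    rw [hdim, hcard]
    nlinarith only [hr2', hqr']
  · zify
    refine hD.trans_lt ?_
    have := (lt_choose_two_iff (c := 3 * (k : ℤ) + c) hkpos.le).2 hkc'
    rwa [show (k : ℤ) + 1 = ((k + 1 : ℕ) : ℤ) by push_cast; rfl, Int.toNat_natCast] at this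
  · rw [← hN]
    zify
    rw [hcard]
    rw [hc, hdim] at hD
    linarith
  · rw [← hN, hq]
    refine le_trans ?_ hnq
    zify
    rw [hcard]
    linarith [Int.natCast_nonneg I.card]
  · rw [hq]
    have h1 := Nat.le_ceil (8 / ε)
    have h2 : ((⌈8 / ε⌉₊ : ℕ) : ℝ) + 1 ≤ q := by exact_mod_cast hq2
    rw [div_le_iff₀ hε, mul_comm] at h1
    refine h1.trans ?_
    gcongr
    linarith
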